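/- For integers $k\ge 0$ let $G(k)=\sum_{j=0}^{k-1}\frac{1}{(2j+1)^2}$ (so $G(0)=0$). Let $x$ be a real number with $|x|\le 1$; empty sums are $0$. (a) For every even integer $n\ge 0$ (with $x\ne 0$ if $n\ge 2$), the following series converges absolutely and $$\sum_{k=0}^\infty\frac{\binom{2k}{k}G(k)\,x^{2k+1}}{4^k(2k+1+n)} =\frac{\binom{n}{n/2}}{4(2x)^{n}}\Bigg(\frac{2}{3}\arcsin^3 x-\sqrt{1-x^2}\,\arcsin^2 x\sum_{j=0}^{\frac{n-2}{2}}\frac{(2x)^{2j+1}}{\binom{2j}{j}(2j+1)} +\arcsin x\sum_{j=1}^{\frac n2}\bigg(\frac{(2x)^{2j}}{\binom{2j}{j}}-1\bigg)\frac{1}{j^2} +\frac{\sqrt{1-x^2}}{2}\sum_{r=0}^{\frac{n-2}{2}}\bigg(\sum_{j=r+1}^{n/2}\frac{1}{j^2}\bigg)\frac{(2x)^{2r+1}}{\binom{2r}{r}(2r+1)}\Bigg).$$ (b) For every odd integer $n\ge 1$ and $x\neq 0$, the following series converges absolutely and $$\sum_{k=0}^\infty\frac{\binom{2k}{k}G(k)\,x^{2k+1}}{4^k(2k+1+n)}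 =\frac{\left(\frac{2}{x}\right)^n}{2n\binom{n-1}{\frac{n-1}{2}}}\Bigg(-\frac{\sqrt{1-x^2}\,\arcsin^2 x}{2}\sum_{j=0}^{\frac{n-1}{2}}\binom{2j}{j}\Big(\frac x2\Big)^{2j} +2\arcsin x\sum_{j=0}^{\frac{n-1}{2}}\frac{\binom{2j}{j}}{2j+1}\Big(\frac x2\Big)^{2j+1} +\sqrt{1-x^2}\sum_{r=0}^{\frac{n-1}{2}}\bigg(\sum_{j=r}^{\frac{n-1}{2}}\frac{1}{(2j+1)^2}\bigg)\binom{2r}{r}\Big(\frac x2\Big)^{2r} -\sum_{j=0}^{\frac{n-1}{2}}\frac{1}{(2j+1)^2}\Bigg).$$ -/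

import Mathlib

/-- The generalized harmonic number `G(k) = ∑_{j=0}^{k-1} 1 / (2j+1)^2`. -/
noncomputable def oddHarmonicTwo (k : ℕ) : ℝ :=
  ∑ j ∈ Finset.range k, 1 / (2 * (j : ℝ) + 1) ^ 2

/-! The coefficients have generating function `arcsin x ^ 2 / (2 * √(1 - x ^ 2))`
(`tsum_normCentralBinom_mul_oddHarmonicTwo`). Multiplying by `x ^ n` and integrating termwise from 0
gives `x ^ n` times the wanted series, so it suffices to exhibit a primitive of `x ^ n * arcsin x ^
2 / (2 * √(1 - x ^ 2))` vanishing at 0.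

Up to a constant factor, `evenPrimitive` and `oddPrimitive` are such primitives. Each is checked by
induction on `m`: the increment is what two integrations by parts produce, and its derivative
collapses because `√(1 - x ^ 2)` times a partial sum of the basic monomials has a telescoping
derivative.

This works for `|x| < 1`. The endpoints follow in `hasSum_of_hasDerivAt` from nonnegative
coefficients and continuity of the primitive. -/

open Real

/-- The normalized central binomial coefficient `binom(2k, k) / 4^k`. -/
noncomputable def normCentralBinom (k : ℕ) : ℝ := (k.centralBinom : ℝ) / 4 ^ k

/-! ### Recurrence and crude bounds for the coefficients -/

lemma centralBinom_succ_real (k : ℕ) :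
    ((k : ℝ) + 1) * ((k + 1).centralBinom : ℝ) = 2 * (2 * k + 1) * (k.centralBinom : ℝ) := by
  exact_mod_cast Nat.succ_mul_centralBinom_succ k

lemma centralBinom_real_pos (k : ℕ) : (0 : ℝ) < (k.centralBinom : ℝ) := by
  exact_mod_cast k.centralBinom_pos

lemma normCentralBinom_nonneg (k : ℕ) : 0 ≤ normCentralBinom k := by
  unfold normCentralBinom; positivity

lemma normCentralBinom_le_one (k : ℕ) : normCentralBinom k ≤ 1 := by
  unfold normCentralBinom
  rw [div_le_one (by positivity)]
  exact_mod_cast Nat.centralBinom_le_four_pow k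

lemma normCentralBinom_succ (k : ℕ) :
    (2 * (k : ℝ) + 2) * normCentralBinom (k + 1) = (2 * k + 1) * normCentralBinom k := by
  unfold normCentralBinom
  have := centralBinom_succ_real k
  rw [pow_succ]
  field_simp
  linear_combination 2 * this

lemma oddHarmonicTwo_nonneg (k : ℕ) : 0 ≤ oddHarmonicTwo k := by
  unfold oddHarmonicTwo; positivity

lemma oddHarmonicTwo_le (k : ℕ) : oddHarmonicTwo k ≤ k := by
  unfold oddHarmonicTwo
  calc _ ≤ ∑ j ∈ Finset.range k, (1 : ℝ) := by
        refine Finset.sum_le_sum fun j _ => ?_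
        rw [div_le_one (by positivity)]
        exact one_le_pow₀ (by linarith [j.cast_nonneg (α := ℝ)])
    _ = k := by simp

lemma abs_le_succ_normCentralBinom_mul (k : ℕ) :
    |normCentralBinom k * oddHarmonicTwo k| ≤ k + 1 := by
  rw [abs_of_nonneg (mul_nonneg (normCentralBinom_nonneg k) (oddHarmonicTwo_nonneg k))]
  have := mul_le_mul (normCentralBinom_le_one k) (oddHarmonicTwo_le k)
    (oddHarmonicTwo_nonneg k) zero_le_one
  linarith

lemma abs_normCentralBinom_div_le {k : ℕ} {d : ℝ} (hd : 1 ≤ d) :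
    |normCentralBinom k / d| ≤ k + 1 := by
  rw [abs_of_nonneg (div_nonneg (normCentralBinom_nonneg k) (by linarith))]
  have := div_le_self (normCentralBinom_nonneg k) hd
  linarith [normCentralBinom_le_one k, k.cast_nonneg (α := ℝ)]

/-! ### Power series with linearly bounded coefficients -/

lemma summable_linear_bound (e : ℕ) {r : ℝ} (hr0 : 0 < r) (hr1 : r < 1) :
    Summable fun k : ℕ => ((k : ℝ) + 1) * ((2 * k + e) * (r ^ k / r)) := by
  have hr : ‖r‖ < 1 := by rwa [Real.norm_of_nonneg hr0.le]
  have h0 := (summable_pow_mul_geometric_of_norm_lt_one 0 hr).mul_left ((e : ℝ) / r)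
  have h1 := (summable_pow_mul_geometric_of_norm_lt_one 1 hr).mul_left ((2 + e : ℝ) / r)
  have h2 := (summable_pow_mul_geometric_of_norm_lt_one 2 hr).mul_left (2 / r)
  refine ((h0.add h1).add h2).congr fun k => ?_
  ring

lemma abs_deriv_term_le {c : ℕ → ℝ} (hc : ∀ k, |c k| ≤ k + 1) (e k : ℕ) {r y : ℝ}
    (hr0 : 0 < r) (hr1 : r < 1) (hy : |y| ≤ r) :
    |c k * ((2 * k + e : ℕ) * y ^ (2 * k + e - 1))| ≤ (k + 1) * ((2 * k + e) * (r ^ k / r)) := by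
  rw [abs_mul, abs_mul, abs_pow, Nat.abs_cast]
  push_cast
  have h : |y| ^ (2 * k + e - 1) ≤ r ^ k / r := by
    refine (pow_le_pow_left₀ (abs_nonneg y) hy _).trans ?_
    -- The spare factor `1 / r` absorbs the `- 1` in the exponent, including its truncation at `k =
    -- e = 0`.
    rw [le_div_iff₀ hr0, ← pow_succ]
    exact pow_le_pow_of_le_one hr0.le hr1.le (by omega)
  gcongr
  exact hc k

lemma summable_deriv_term {c : ℕ → ℝ} (hc : ∀ k, |c k| ≤ k + 1) (e : ℕ) {x : ℝ} (hx : |x| < 1) :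
    Summable fun k : ℕ => c k * ((2 * k + e : ℕ) * x ^ (2 * k + e - 1)) := by
  obtain ⟨r, hxr, hr1⟩ := exists_between hx
  have hr0 := (abs_nonneg x).trans_lt hxr
  exact .of_norm_bounded (summable_linear_bound e hr0 hr1)
    fun k => abs_deriv_term_le hc e k hr0 hr1 hxr.le

lemma summable_term {c : ℕ → ℝ} (hc : ∀ k, |c k| ≤ k + 1) (e : ℕ) {x : ℝ} (hx : |x| < 1) :
    Summable fun k : ℕ => c k * x ^ (2 * k + e) := by
  -- Differentiating the series with one more power of `x` multiplies each term by `2k + e + 1 ≥ 1`.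
  refine .of_norm_bounded (summable_deriv_term hc (e + 1) hx).abs fun k => ?_
  rw [Real.norm_eq_abs, abs_mul, abs_mul, abs_mul, show 2 * k + (e + 1) - 1 = 2 * k + e by omega,
    Nat.abs_cast]
  refine mul_le_mul_of_nonneg_left (le_mul_of_one_le_left (abs_nonneg _) ?_) (abs_nonneg _)
  push_cast
  have := k.cast_nonneg (α := ℝ)
  have := e.cast_nonneg (α := ℝ)
  linarith

lemma hasDerivAt_tsum_term {c : ℕ → ℝ} (hc : ∀ k, |c k| ≤ k + 1) (e : ℕ) {x : ℝ} (hx : |x| < 1) :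
    HasDerivAt (fun y => ∑' k : ℕ, c k * y ^ (2 * k + e))
      (∑' k : ℕ, c k * ((2 * k + e : ℕ) * x ^ (2 * k + e - 1))) x := by
  obtain ⟨r, hxr, hr1⟩ := exists_between hx
  have hr0 := (abs_nonneg x).trans_lt hxr
  refine hasDerivAt_tsum_of_isPreconnected (t := Set.Ioo (-r) r) (y₀ := x)
    (summable_linear_bound e hr0 hr1) isOpen_Ioo isPreconnected_Ioo
    (fun k y _ => (hasDerivAt_pow _ y).const_mul (c k))
    (fun k y hy => abs_deriv_term_le hc e k hr0 hr1 (abs_le.2 ⟨hy.1.le, hy.2.le⟩))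
    (abs_lt.1 hxr) (summable_term hc e hx) (abs_lt.1 hxr)

/-! ### The generating function of the coefficients -/

lemma eqOn_of_hasDerivAt {f g f' : ℝ → ℝ} (hf : ∀ x, |x| < 1 → HasDerivAt f (f' x) x)
    (hg : ∀ x, |x| < 1 → HasDerivAt g (f' x) x) (h0 : f 0 = g 0) {x : ℝ} (hx : |x| < 1) :
    f x = g x := by
  refine IsOpen.eqOn_of_deriv_eq (s := Set.Ioo (-1 : ℝ) 1) isOpen_Ioo isPreconnected_Ioo
    (fun y hy => (hf y (abs_lt.2 hy)).differentiableAt.differentiableWithinAt)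
    (fun y hy => (hg y (abs_lt.2 hy)).differentiableAt.differentiableWithinAt)
    (fun y hy => ?_) (show (0 : ℝ) ∈ _ by norm_num) h0 (abs_lt.1 hx)
  rw [(hf y (abs_lt.2 hy)).deriv, (hg y (abs_lt.2 hy)).deriv]

lemma sqrt_one_sub_sq_pos {x : ℝ} (hx : |x| < 1) : 0 < √(1 - x ^ 2) :=
  Real.sqrt_pos.2 (by have := (sq_lt_one_iff_abs_lt_one x).2 hx; linarith)

lemma sq_sqrt_one_sub_sq {x : ℝ} (hx : |x| < 1) : √(1 - x ^ 2) ^ 2 = 1 - x ^ 2 :=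
  Real.sq_sqrt (by have := (sq_lt_one_iff_abs_lt_one x).2 hx; linarith)

lemma hasDerivAt_sqrt_one_sub_sq {x : ℝ} (hx : |x| < 1) :
    HasDerivAt (fun y : ℝ => √(1 - y ^ 2)) (-x / √(1 - x ^ 2)) x := by
  have h := (((hasDerivAt_pow 2 x).const_sub 1).sqrt (by
    have := (sq_lt_one_iff_abs_lt_one x).2 hx; linarith))
  convert h using 1
  have := sqrt_one_sub_sq_pos hx
  field_simp
  norm_num [mul_comm]

lemma hasDerivAt_arcsin_of_abs_lt {x : ℝ} (hx : |x| < 1) :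
    HasDerivAt arcsin (1 / √(1 - x ^ 2)) x :=
  Real.hasDerivAt_arcsin (abs_lt.1 hx).1.ne' (abs_lt.1 hx).2.ne

/-- A three-term coefficient recurrence translates into a first-order linear differential
equation with integrating factor `√(1 - x²)`. -/
lemma hasDerivAt_tsum_mul_sqrt {c d : ℕ → ℝ} (hc : ∀ k, |c k| ≤ k + 1)
    (hcd : ∀ k : ℕ, (2 * (k : ℝ) + 2) * c (k + 1) = (2 * k + 1) * c k + d k) {x : ℝ}
    (hx : |x| < 1) :
    HasDerivAt (fun y => (∑' k : ℕ, c k * y ^ (2 * k + 0)) * √(1 - y ^ 2))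
      ((∑' k : ℕ, d k * x ^ (2 * k + 1)) / √(1 - x ^ 2)) x := by
  have hD := (summable_deriv_term hc 0 hx)
  have hF := (summable_term hc 0 hx)
  have hder := (hasDerivAt_tsum_term hc 0 hx).mul (hasDerivAt_sqrt_one_sub_sq hx)
  set F' := ∑' k : ℕ, c k * ((2 * k + 0 : ℕ) * x ^ (2 * k + 0 - 1)) with hF'
  set F := ∑' k : ℕ, c k * x ^ (2 * k + 0) with hFdef
  have h1 : HasSum (fun k : ℕ => c (k + 1) * ((2 * (k + 1) + 0 : ℕ) * x ^ (2 * (k + 1) + 0 - 1)))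
      F' := by
    have := (hasSum_nat_add_iff' 1).2 hD.hasSum
    rwa [← hF', Finset.sum_range_one, mul_zero, Nat.add_zero, Nat.cast_zero, zero_mul, mul_zero,
      sub_zero] at this
  have h2 : HasSum _ (x ^ 2 * F') := hD.hasSum.mul_left (x ^ 2)
  have h3 : HasSum _ (x * F) := hF.hasSum.mul_left x
  -- Comparing coefficients, the recurrence says `(1 - x²) F' - x F = ∑ d k x^(2k+1)`.
  have h4 : HasSum (fun k : ℕ => d k * x ^ (2 * k + 1)) (F' - x ^ 2 * F' - x * F) := by
    refine ((h1.sub h2).sub h3).congr_fun fun k => ?_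
    have e2 : x ^ 2 * (c k * ((2 * k + 0 : ℕ) * x ^ (2 * k + 0 - 1)))
        = c k * (2 * k) * x ^ (2 * k + 1) := by
      rcases k with _ | k
      · simp
      · rw [show 2 * (k + 1) + 0 - 1 = 2 * k + 1 by omega]
        push_cast
        ring
    rw [e2, show 2 * (k + 1) + 0 - 1 = 2 * k + 1 by omega]
    push_cast
    linear_combination (-x ^ (2 * k + 1)) * hcd k
  refine hder.congr_deriv ?_
  have hs := sqrt_one_sub_sq_pos hx
  have hs2 := sq_sqrt_one_sub_sq hx
  rw [h4.tsum_eq]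
  field_simp
  rw [hs2]
  ring

/-- Here the recurrence is homogeneous, so the series times `√(1 - x ^ 2)` is constant. -/
lemma tsum_normCentralBinom {x : ℝ} (hx : |x| < 1) :
    ∑' k : ℕ, normCentralBinom k * x ^ (2 * k + 0) = 1 / √(1 - x ^ 2) := by
  have hc (k : ℕ) : |normCentralBinom k| ≤ k + 1 := by
    simpa using abs_normCentralBinom_div_le (k := k) le_rfl
  have h := eqOn_of_hasDerivAt (f' := fun _ => 0)
    (f := fun y => (∑' k : ℕ, normCentralBinom k * y ^ (2 * k + 0)) * √(1 - y ^ 2))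
    (g := fun _ => 1)
    (fun y hy => by
      simpa using hasDerivAt_tsum_mul_sqrt (d := fun _ => 0) hc
        (fun k => by rw [normCentralBinom_succ, add_zero]) hy)
    (fun y _ => hasDerivAt_const y _)
    (by
      rw [tsum_eq_single 0 fun k hk => by simp [hk]]
      simp [normCentralBinom]) hx
  rw [eq_div_iff (sqrt_one_sub_sq_pos hx).ne']
  exact h

lemma abs_normCentralBinom_div_odd_le (k : ℕ) :
    |normCentralBinom k / (2 * k + 1)| ≤ k + 1 :=
  abs_normCentralBinom_div_le (by linarith [k.cast_nonneg (α := ℝ)])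

lemma tsum_arcsin {x : ℝ} (hx : |x| < 1) :
    ∑' k : ℕ, normCentralBinom k / (2 * k + 1) * x ^ (2 * k + 1) = arcsin x := by
  refine eqOn_of_hasDerivAt (f' := fun x => 1 / √(1 - x ^ 2))
    (f := fun y => ∑' k : ℕ, normCentralBinom k / (2 * k + 1) * y ^ (2 * k + 1))
    (fun y hy => ?_) (fun y hy => hasDerivAt_arcsin_of_abs_lt hy) (by simp) hx
  refine (hasDerivAt_tsum_term abs_normCentralBinom_div_odd_le 1 hy).congr_deriv ?_
  rw [← tsum_normCentralBinom hy]
  refine tsum_congr fun k => ?_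
  push_cast
  rw [add_zero]
  field_simp

/-- The generating function of `binom(2k, k) G(k) / 4^k` is `arcsin² x / (2 √(1 - x²))`. -/
lemma tsum_normCentralBinom_mul_oddHarmonicTwo {x : ℝ} (hx : |x| < 1) :
    ∑' k : ℕ, normCentralBinom k * oddHarmonicTwo k * x ^ (2 * k + 0)
      = arcsin x ^ 2 / (2 * √(1 - x ^ 2)) := by
  have h := eqOn_of_hasDerivAt (f' := fun y => arcsin y / √(1 - y ^ 2))
    (f := fun y =>
      (∑' k : ℕ, normCentralBinom k * oddHarmonicTwo k * y ^ (2 * k + 0)) * √(1 - y ^ 2))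
    (g := fun y => arcsin y ^ 2 / 2)
    (fun y hy => by
      rw [← tsum_arcsin hy]
      refine hasDerivAt_tsum_mul_sqrt abs_le_succ_normCentralBinom_mul (fun k => ?_) hy
      -- The increment of `G` leaves the forcing term `normCentralBinom k / (2k + 1)`, the arcsine
      -- coefficient.
      have h1 : oddHarmonicTwo (k + 1) = oddHarmonicTwo k + 1 / (2 * (k : ℝ) + 1) ^ 2 :=
        Finset.sum_range_succ _ _
      rw [← mul_assoc, normCentralBinom_succ, h1]
      field_simp)
    (fun y hy => by
      refine (((hasDerivAt_arcsin_of_abs_lt hy).pow 2).div_const 2).congr_deriv ?_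
      norm_num
      ring)
    (by
      rw [tsum_eq_single 0 fun k hk => by simp [hk]]
      simp [oddHarmonicTwo]) hx
  have hs := sqrt_one_sub_sq_pos hx
  rw [eq_div_iff (by positivity)]
  linear_combination 2 * h

/-! ### Termwise integration -/

lemma hasSum_of_hasDerivAt_of_abs_lt {n : ℕ} {R : ℝ → ℝ} (h0 : R 0 = 0)
    (hR : ∀ x, |x| < 1 → HasDerivAt R (x ^ n * (arcsin x ^ 2 / (2 * √(1 - x ^ 2)))) x)
    {x : ℝ} (hx : |x| < 1) :
    HasSum (fun k : ℕ => normCentralBinom k * oddHarmonicTwo k / (2 * k + 1 + n)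
      * x ^ (2 * k + (1 + n))) (R x) := by
  have hc (k : ℕ) : |normCentralBinom k * oddHarmonicTwo k / (2 * k + 1 + n)| ≤ k + 1 := by
    rw [abs_div]
    refine (div_le_self (abs_nonneg _) ?_).trans (abs_le_succ_normCentralBinom_mul k)
    refine le_trans ?_ (le_abs_self _)
    linarith [k.cast_nonneg (α := ℝ), n.cast_nonneg (α := ℝ)]
  have h := eqOn_of_hasDerivAt (g := R)
    (f := fun y => ∑' k : ℕ, normCentralBinom k * oddHarmonicTwo k / (2 * k + 1 + n)
      * y ^ (2 * k + (1 + n))) (fun y hy => ?_) hR (by simp [h0]) hx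
  · rw [← h]
    exact (summable_term hc _ hx).hasSum
  · refine (hasDerivAt_tsum_term hc (1 + n) hy).congr_deriv ?_
    rw [← tsum_normCentralBinom_mul_oddHarmonicTwo hy, ← tsum_mul_left]
    refine tsum_congr fun k => ?_
    rw [show 2 * k + (1 + n) - 1 = n + 2 * k by omega, pow_add]
    have : (0 : ℝ) < 2 * k + 1 + n := by positivity
    push_cast
    field_simp
    ring_nf

/-- An Abel-type extension to the closed interval, using nonnegativity of the coefficients. -/
lemma hasSum_of_hasDerivAt {n : ℕ} {R : ℝ → ℝ} (hcont : Continuous R) (h0 : R 0 = 0)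
    (hR : ∀ x, |x| < 1 → HasDerivAt R (x ^ n * (arcsin x ^ 2 / (2 * √(1 - x ^ 2)))) x)
    {x : ℝ} (hx : |x| ≤ 1) :
    HasSum (fun k : ℕ => normCentralBinom k * oddHarmonicTwo k / (2 * k + 1 + n)
      * x ^ (2 * k + (1 + n))) (R x) := by
  set t : ℕ → ℝ := fun k => normCentralBinom k * oddHarmonicTwo k / (2 * k + 1 + n) with ht
  have htn (k : ℕ) : 0 ≤ t k :=
    div_nonneg (mul_nonneg (normCentralBinom_nonneg k) (oddHarmonicTwo_nonneg k)) (by positivity)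
  have hlt {y : ℝ} (hy : |y| < 1) : HasSum (fun k => t k * y ^ (2 * k + (1 + n))) (R y) :=
    hasSum_of_hasDerivAt_of_abs_lt h0 hR hy
  -- For `0 < y < 1` each partial sum is at most `R y`; letting `y → 1` bounds the partial sums of
  -- `t` by `R 1`.
  have hsum : Summable t := by
    refine summable_of_sum_range_le (c := R 1) htn fun N => ?_
    have := le_on_closure (s := Set.Ioo (0 : ℝ) 1)
      (f := fun y => ∑ k ∈ Finset.range N, t k * y ^ (2 * k + (1 + n))) (g := R) (x := 1)
      (fun y hy => sum_le_hasSum _ (fun k _ => mul_nonneg (htn k) (pow_nonneg hy.1.le _))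
        (hlt (abs_lt.2 ⟨by linarith [hy.1], hy.2⟩)))
      (by fun_prop) hcont.continuousOn (by rw [closure_Ioo zero_ne_one]; simp)
    simpa using this
  have hle (k : ℕ) {y : ℝ} (hy : |y| ≤ 1) : ‖t k * y ^ (2 * k + (1 + n))‖ ≤ t k := by
    rw [norm_mul, Real.norm_of_nonneg (htn k), norm_pow]
    exact mul_le_of_le_one_right (htn k) (pow_le_one₀ (norm_nonneg _) hy)
  -- By the Weierstrass M-test with majorant `t`, both sides are continuous on the closed interval.
  have heq : Set.EqOn (fun y => ∑' k, t k * y ^ (2 * k + (1 + n))) R (Set.Icc (-1) 1) :=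
    Set.EqOn.of_subset_closure (s := Set.Ioo (-1 : ℝ) 1)
      (fun y hy => (hlt (abs_lt.2 hy)).tsum_eq)
      (continuousOn_tsum (fun k => by fun_prop) hsum fun k y hy => hle k (abs_le.2 hy))
      hcont.continuousOn Set.Ioo_subset_Icc_self (by rw [closure_Ioo (by norm_num)])
  rw [← heq (abs_le.1 hx)]
  exact (Summable.of_norm_bounded hsum fun k => hle k hx).hasSum

/-! ### The primitive for even exponents -/

/-- `(2x)^(2j) / binom(2j, j)` -/
noncomputable def evenTerm (x : ℝ) (j : ℕ) : ℝ := (2 * x) ^ (2 * j) / (j.centralBinom : ℝ)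

/-- `(2x)^(2j+1) / (binom(2j, j) (2j+1))` -/
noncomputable def oddTerm (x : ℝ) (j : ℕ) : ℝ :=
  (2 * x) ^ (2 * j + 1) / ((j.centralBinom : ℝ) * (2 * (j : ℝ) + 1))

lemma centralBinom_succ_div (j : ℕ) :
    ((j + 1).centralBinom : ℝ) = 2 * (2 * j + 1) * (j.centralBinom : ℝ) / (j + 1) := by
  rw [eq_div_iff (by positivity), ← centralBinom_succ_real]
  ring

lemma evenTerm_zero (x : ℝ) : evenTerm x 0 = 1 := by simp [evenTerm]

lemma mul_oddTerm (x : ℝ) (j : ℕ) : x * oddTerm x j = evenTerm x (j + 1) / (j + 1) := by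
  have := centralBinom_real_pos j
  rw [evenTerm, oddTerm, centralBinom_succ_div]
  field_simp
  ring

lemma sq_mul_evenTerm (x : ℝ) (j : ℕ) :
    x ^ 2 * evenTerm x j = evenTerm x (j + 1) * (2 * j + 1) / (2 * (j + 1)) := by
  have := centralBinom_real_pos j
  rw [evenTerm, evenTerm, centralBinom_succ_div]
  field_simp
  ring

lemma hasDerivAt_oddTerm (x : ℝ) (j : ℕ) :
    HasDerivAt (fun y => oddTerm y j) (2 * evenTerm x j) x := by
  have := centralBinom_real_pos j
  refine ((((hasDerivAt_id x).const_mul 2).pow (2 * j + 1)).div_const _).congr_deriv ?_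
  rw [evenTerm, Nat.add_sub_cancel]
  push_cast
  field_simp
  simp

lemma hasDerivAt_evenTerm (x : ℝ) (j : ℕ) :
    HasDerivAt (fun y => evenTerm y (j + 1)) (2 * (j + 1) ^ 2 * oddTerm x j) x := by
  have := centralBinom_real_pos j
  refine ((((hasDerivAt_id x).const_mul 2).pow (2 * (j + 1))).div_const _).congr_deriv ?_
  rw [oddTerm, centralBinom_succ_div, show 2 * (j + 1) - 1 = 2 * j + 1 by omega]
  push_cast
  field_simp
  simp

/-- The `j`-th summand contributes `2 * (evenTerm x j - evenTerm x (j + 1)) / √(1 - x ^ 2)`, so the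
sum telescopes. -/
lemma hasDerivAt_sqrt_mul_sum_oddTerm {x : ℝ} (hx : |x| < 1) (m : ℕ) :
    HasDerivAt (fun y => √(1 - y ^ 2) * ∑ j ∈ Finset.range m, oddTerm y j)
      (-2 * (evenTerm x m - 1) / √(1 - x ^ 2)) x := by
  have hs := sqrt_one_sub_sq_pos hx
  have hs2 := sq_sqrt_one_sub_sq hx
  induction m with
  | zero => simpa [evenTerm_zero] using hasDerivAt_const x (0 : ℝ)
  | succ m ih =>
    simp only [Finset.sum_range_succ, mul_add]
    refine (ih.add ((hasDerivAt_sqrt_one_sub_sq hx).mul (hasDerivAt_oddTerm x m))).congr_deriv ?_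
    have h1 := mul_oddTerm x m
    have h2 := sq_mul_evenTerm x m
    field_simp at h1 h2 ⊢
    rw [hs2]
    apply mul_right_cancel₀ (b := (m : ℝ) + 1) (by positivity)
    linear_combination -h1 - h2

/-- The closed form, without its prefactor, for the exponent `2m`. -/
noncomputable def evenPrimitive (m : ℕ) (x : ℝ) : ℝ :=
  (2 / 3 : ℝ) * arcsin x ^ 3
    - √(1 - x ^ 2) * arcsin x ^ 2 * (∑ j ∈ Finset.range m, oddTerm x j)
    + arcsin x * (∑ j ∈ Finset.Icc 1 m, (evenTerm x j - 1) * (1 / (j : ℝ) ^ 2))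
    + √(1 - x ^ 2) / 2 *
      (∑ r ∈ Finset.range m, (∑ j ∈ Finset.Icc (r + 1) m, 1 / (j : ℝ) ^ 2) * oddTerm x r)

/-- Passing to `m + 1` adds `1 / (m + 1) ^ 2` to every inner sum, so the double sum grows by a plain
sum of `oddTerm`, whose product with the root has a known derivative. -/
lemma evenPrimitive_succ (m : ℕ) (x : ℝ) :
    evenPrimitive (m + 1) x = evenPrimitive m x
      + (-(arcsin x ^ 2 * (√(1 - x ^ 2) * oddTerm x m))
        + arcsin x * (evenTerm x (m + 1) - 1) / (m + 1) ^ 2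
        + (√(1 - x ^ 2) * ∑ r ∈ Finset.range (m + 1), oddTerm x r) / (m + 1) ^ 2 / 2) := by
  have h : ∑ r ∈ Finset.range (m + 1),
      (∑ j ∈ Finset.Icc (r + 1) (m + 1), 1 / (j : ℝ) ^ 2) * oddTerm x r
      = (∑ r ∈ Finset.range m, (∑ j ∈ Finset.Icc (r + 1) m, 1 / (j : ℝ) ^ 2) * oddTerm x r)
        + (∑ r ∈ Finset.range (m + 1), oddTerm x r) / (m + 1) ^ 2 := by
    rw [Finset.sum_congr rfl fun r hr => by
      rw [Finset.sum_Icc_succ_top (by have := Finset.mem_range.1 hr; omega), add_mul],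
      Finset.sum_add_distrib, Finset.sum_range_succ, Finset.Icc_eq_empty (by omega),
      Finset.sum_empty, zero_mul, add_zero, ← Finset.mul_sum]
    push_cast
    ring
  rw [evenPrimitive, evenPrimitive, h, Finset.sum_Icc_succ_top (by omega),
    Finset.sum_range_succ (fun j => oddTerm x j) m]
  push_cast
  ring

lemma evenPrimitive_apply_zero (m : ℕ) : evenPrimitive m 0 = 0 := by
  simp [evenPrimitive, oddTerm]

lemma continuous_evenPrimitive (m : ℕ) : Continuous (evenPrimitive m) := by
  unfold evenPrimitive evenTerm oddTerm
  fun_prop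

lemma hasDerivAt_evenPrimitive {x : ℝ} (hx : |x| < 1) (m : ℕ) :
    HasDerivAt (evenPrimitive m) (2 * evenTerm x m * arcsin x ^ 2 / √(1 - x ^ 2)) x := by
  have hs := sqrt_one_sub_sq_pos hx
  have hs2 := sq_sqrt_one_sub_sq hx
  have hA := hasDerivAt_arcsin_of_abs_lt hx
  induction m with
  | zero =>
    have h : evenPrimitive 0 = fun y => (2 / 3 : ℝ) * arcsin y ^ 3 := by
      ext y; simp [evenPrimitive]
    rw [h, evenTerm_zero]
    refine ((hA.pow 3).const_mul _).congr_deriv ?_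
    norm_num
    ring
  | succ m ih =>
    rw [funext (evenPrimitive_succ m)]
    have hS := hasDerivAt_sqrt_mul_sum_oddTerm hx (m + 1)
    refine (ih.add ((((hA.pow 2).mul ((hasDerivAt_sqrt_one_sub_sq hx).mul
      (hasDerivAt_oddTerm x m))).neg.add ((hA.mul ((hasDerivAt_evenTerm x m).sub_const 1)).div_const
        _)).add ((hS.div_const _).div_const _))).congr_deriv ?_
    have h1 := mul_oddTerm x m
    have h2 := sq_mul_evenTerm x m
    simp only [Pi.mul_apply, Pi.pow_apply]
    field_simp at h1 h2 ⊢
    norm_num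
    rw [hs2]
    -- The terms linear in `arcsin` and those free of it cancel; only the `arcsin ^ 2` part needs
    -- the recurrences.
    linear_combination arcsin x ^ 2 * (m + 1) * (h1 + h2)

/-! ### The primitive for odd exponents -/

/-- `binom(2j, j) (x/2)^(2j)` -/
noncomputable def binomTerm (x : ℝ) (j : ℕ) : ℝ := (j.centralBinom : ℝ) * (x / 2) ^ (2 * j)

/-- The derivative of `binomTerm`. -/
noncomputable def binomTermDeriv (x : ℝ) (j : ℕ) : ℝ :=
  j * (j.centralBinom : ℝ) * (x / 2) ^ (2 * j - 1)

lemma hasDerivAt_binomTerm (x : ℝ) (j : ℕ) :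
    HasDerivAt (fun y => binomTerm y j) (binomTermDeriv x j) x := by
  refine ((((hasDerivAt_id x).div_const 2).pow (2 * j)).const_mul _).congr_deriv ?_
  rw [binomTermDeriv]
  push_cast
  simp
  ring

lemma binomTermDeriv_zero (x : ℝ) : binomTermDeriv x 0 = 0 := by simp [binomTermDeriv]

lemma mul_binomTermDeriv (x : ℝ) (j : ℕ) : x * binomTermDeriv x j = 2 * j * binomTerm x j := by
  rcases j with _ | j
  · simp [binomTermDeriv]
  · rw [binomTermDeriv, binomTerm, show 2 * (j + 1) - 1 = 2 * j + 1 by omega]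
    push_cast
    ring

lemma binomTermDeriv_succ (x : ℝ) (j : ℕ) :
    binomTermDeriv x (j + 1) = (2 * j + 1) * x * binomTerm x j := by
  rw [binomTermDeriv, binomTerm, show 2 * (j + 1) - 1 = 2 * j + 1 by omega]
  push_cast
  rw [centralBinom_succ_real]
  ring

/-- The `j`-th summand contributes `(binomTermDeriv x j - binomTermDeriv x (j + 1)) / √(1 - x ^ 2)`,
which telescopes from `binomTermDeriv x 0 = 0`. -/
lemma hasDerivAt_sqrt_mul_sum_binomTerm {x : ℝ} (hx : |x| < 1) (m : ℕ) :
    HasDerivAt (fun y => √(1 - y ^ 2) * ∑ j ∈ Finset.range m, binomTerm y j)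
      (-binomTermDeriv x m / √(1 - x ^ 2)) x := by
  have hs := sqrt_one_sub_sq_pos hx
  have hs2 := sq_sqrt_one_sub_sq hx
  induction m with
  | zero => simpa [binomTermDeriv_zero] using hasDerivAt_const x (0 : ℝ)
  | succ m ih =>
    simp only [Finset.sum_range_succ, mul_add]
    refine (ih.add ((hasDerivAt_sqrt_one_sub_sq hx).mul (hasDerivAt_binomTerm x m))).congr_deriv ?_
    have h1 := mul_binomTermDeriv x m
    rw [binomTermDeriv_succ]
    field_simp
    rw [hs2]
    linear_combination -x * h1

/-- The closed form, without its prefactor, for the exponent `2m - 1`. -/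
noncomputable def oddPrimitive (m : ℕ) (x : ℝ) : ℝ :=
  -(√(1 - x ^ 2) * arcsin x ^ 2 / 2) * (∑ j ∈ Finset.range m, binomTerm x j)
    + arcsin x * (∑ j ∈ Finset.range m, x * binomTerm x j / (2 * (j : ℝ) + 1))
    + √(1 - x ^ 2) *
      (∑ r ∈ Finset.range m, (∑ j ∈ Finset.Ico r m, 1 / (2 * (j : ℝ) + 1) ^ 2) * binomTerm x r)
    - ∑ j ∈ Finset.range m, 1 / (2 * (j : ℝ) + 1) ^ 2

lemma oddPrimitive_succ (m : ℕ) (x : ℝ) :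
    oddPrimitive (m + 1) x = oddPrimitive m x
      + (-(arcsin x ^ 2 * (√(1 - x ^ 2) * binomTerm x m) / 2)
        + arcsin x * (x * binomTerm x m) / (2 * m + 1)
        + (√(1 - x ^ 2) * ∑ r ∈ Finset.range (m + 1), binomTerm x r) / (2 * m + 1) ^ 2
        - 1 / (2 * m + 1) ^ 2) := by
  have h : ∑ r ∈ Finset.range (m + 1),
      (∑ j ∈ Finset.Ico r (m + 1), 1 / (2 * (j : ℝ) + 1) ^ 2) * binomTerm x r
      = (∑ r ∈ Finset.range m, (∑ j ∈ Finset.Ico r m, 1 / (2 * (j : ℝ) + 1) ^ 2) * binomTerm x r)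
        + (∑ r ∈ Finset.range (m + 1), binomTerm x r) / (2 * m + 1) ^ 2 := by
    rw [Finset.sum_congr rfl fun r hr => by
      rw [Finset.sum_Ico_succ_top (by have := Finset.mem_range.1 hr; omega), add_mul],
      Finset.sum_add_distrib, Finset.sum_range_succ, Finset.Ico_self,
      Finset.sum_empty, zero_mul, add_zero, ← Finset.mul_sum]
    ring
  rw [oddPrimitive, oddPrimitive, h, Finset.sum_range_succ (fun j => binomTerm x j) m,
    Finset.sum_range_succ (fun j => x * binomTerm x j / (2 * (j : ℝ) + 1)) m,
    Finset.sum_range_succ (fun j : ℕ => 1 / (2 * (j : ℝ) + 1) ^ 2) m]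
  ring

lemma sum_binomTerm_zero (m : ℕ) : ∑ r ∈ Finset.range (m + 1), binomTerm 0 r = 1 := by
  rw [Finset.sum_eq_single 0 (fun r _ hr => by simp [binomTerm, hr]) (by simp)]
  simp [binomTerm]

/-- This is the role of the subtracted constant: at 0 the root and the sum of `binomTerm` are both
1. -/
lemma oddPrimitive_apply_zero (m : ℕ) : oddPrimitive m 0 = 0 := by
  induction m with
  | zero => simp [oddPrimitive]
  | succ m ih =>
    rw [oddPrimitive_succ, ih, sum_binomTerm_zero]
    simp

lemma continuous_oddPrimitive (m : ℕ) : Continuous (oddPrimitive m) := by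
  unfold oddPrimitive binomTerm
  fun_prop

lemma hasDerivAt_oddPrimitive {x : ℝ} (hx : |x| < 1) (m : ℕ) :
    HasDerivAt (oddPrimitive m) (binomTermDeriv x m * (arcsin x ^ 2 / (2 * √(1 - x ^ 2)))) x := by
  have hs := sqrt_one_sub_sq_pos hx
  have hs2 := sq_sqrt_one_sub_sq hx
  have hA := hasDerivAt_arcsin_of_abs_lt hx
  induction m with
  | zero =>
    have h : oddPrimitive 0 = fun _ => 0 := by
      ext y; simp [oddPrimitive]
    rw [h, binomTermDeriv_zero, zero_mul]
    exact hasDerivAt_const x _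
  | succ m ih =>
    rw [funext (oddPrimitive_succ m)]
    have hS := hasDerivAt_sqrt_mul_sum_binomTerm hx (m + 1)
    have hu := hasDerivAt_binomTerm x m
    refine (ih.add ((((((hA.pow 2).mul ((hasDerivAt_sqrt_one_sub_sq hx).mul hu)).div_const
      2).neg.add ((hA.mul ((hasDerivAt_id x).mul hu)).div_const _)).add
        (hS.div_const _)).sub_const _)).congr_deriv ?_
    have h1 := mul_binomTermDeriv x m
    rw [binomTermDeriv_succ]
    simp only [Pi.mul_apply, Pi.pow_apply, id]
    field_simp
    norm_num
    rw [hs2]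
    linear_combination (arcsin x ^ 2 * (2 * m + 1) * x + 2 * arcsin x * √(1 - x ^ 2)) * h1

/-! ### The two evaluations -/

/-- Dividing the integrated series by `x ^ n`. -/
lemma hasSum_div_pow {n : ℕ} {R : ℝ → ℝ} {c S x : ℝ} (hcont : Continuous R) (h0 : R 0 = 0)
    (hR : ∀ y, |y| < 1 → HasDerivAt R (c * y ^ n * (arcsin y ^ 2 / (2 * √(1 - y ^ 2)))) y)
    (hc : c ≠ 0) (hx : |x| ≤ 1) (hxn : x ^ n ≠ 0) (hS : c * x ^ n * S = R x) :
    HasSum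
      (fun k : ℕ =>
        ((Nat.choose (2 * k) k : ℕ) : ℝ) * oddHarmonicTwo k * x ^ (2 * k + 1)
          / ((4 : ℝ) ^ k * (2 * (k : ℝ) + 1 + (n : ℝ)))) S := by
  have h := (hasSum_of_hasDerivAt (n := n) (R := fun y => R y / c) (hcont.div_const c)
    (by simp [h0]) (fun y hy => ((hR y hy).div_const c).congr_deriv (by field_simp)) hx).div_const
      (x ^ n)
  have hS' : R x / c / x ^ n = S := by
    rw [← hS]
    field_simp
  rw [hS'] at h
  refine h.congr_fun fun k => ?_
  rw [normCentralBinom, Nat.centralBinom_eq_two_mul_choose, ← add_assoc, pow_add x (2 * k + 1) n]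
  have : (0 : ℝ) < 2 * k + 1 + n := by positivity
  field_simp

theorem theorem5p2 :
    (∀ (n : ℕ) (x : ℝ), Even n → |x| ≤ 1 → (x ≠ 0 ∨ n = 0) →
      HasSum
        (fun k : ℕ =>
          ((Nat.choose (2 * k) k : ℕ) : ℝ) * oddHarmonicTwo k * x ^ (2 * k + 1)
            / ((4 : ℝ) ^ k * (2 * (k : ℝ) + 1 + (n : ℝ))))
        (((Nat.choose n (n / 2) : ℕ) : ℝ) / (4 * (2 * x) ^ n) *
          ((2 / 3 : ℝ) * Real.arcsin x ^ 3
            - Real.sqrt (1 - x ^ 2) * Real.arcsin x ^ 2 *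
                (∑ j ∈ Finset.range (n / 2),
                  (2 * x) ^ (2 * j + 1)
                    / (((Nat.choose (2 * j) j : ℕ) : ℝ) * (2 * (j : ℝ) + 1)))
            + Real.arcsin x *
                (∑ j ∈ Finset.Icc 1 (n / 2),
                  ((2 * x) ^ (2 * j) / ((Nat.choose (2 * j) j : ℕ) : ℝ) - 1)
                    * (1 / (j : ℝ) ^ 2))
            + Real.sqrt (1 - x ^ 2) / 2 *
                (∑ r ∈ Finset.range (n / 2),
                  (∑ j ∈ Finset.Icc (r + 1) (n / 2), 1 / (j : ℝ) ^ 2)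
                    * ((2 * x) ^ (2 * r + 1)
                      / (((Nat.choose (2 * r) r : ℕ) : ℝ) * (2 * (r : ℝ) + 1)))))))
    ∧
    (∀ (n : ℕ) (x : ℝ), Odd n → |x| ≤ 1 → x ≠ 0 →
      HasSum
        (fun k : ℕ =>
          ((Nat.choose (2 * k) k : ℕ) : ℝ) * oddHarmonicTwo k * x ^ (2 * k + 1)
            / ((4 : ℝ) ^ k * (2 * (k : ℝ) + 1 + (n : ℝ))))
        ((2 / x) ^ n
            / (2 * (n : ℝ) * ((Nat.choose (n - 1) ((n - 1) / 2) : ℕ) : ℝ)) *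
          (-(Real.sqrt (1 - x ^ 2) * Real.arcsin x ^ 2 / 2) *
                (∑ j ∈ Finset.Icc 0 ((n - 1) / 2),
                  ((Nat.choose (2 * j) j : ℕ) : ℝ) * (x / 2) ^ (2 * j))
            + 2 * Real.arcsin x *
                (∑ j ∈ Finset.Icc 0 ((n - 1) / 2),
                  ((Nat.choose (2 * j) j : ℕ) : ℝ) / (2 * (j : ℝ) + 1)
                    * (x / 2) ^ (2 * j + 1))
            + Real.sqrt (1 - x ^ 2) *
                (∑ r ∈ Finset.Icc 0 ((n - 1) / 2),
                  (∑ j ∈ Finset.Icc r ((n - 1) / 2), 1 / (2 * (j : ℝ) + 1) ^ 2)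
                    * ((Nat.choose (2 * r) r : ℕ) : ℝ) * (x / 2) ^ (2 * r))
            - (∑ j ∈ Finset.Icc 0 ((n - 1) / 2), 1 / (2 * (j : ℝ) + 1) ^ 2)))) := by
  constructor
  · rintro n x ⟨m, rfl⟩ hx hxn
    rw [← two_mul] at hxn ⊢
    rw [Nat.mul_div_cancel_left m two_pos]
    have hxn' : x ^ (2 * m) ≠ 0 := by
      rcases hxn with h | h
      · exact pow_ne_zero _ h
      · simp [h]
    have hC := centralBinom_real_pos m
    -- `c * y ^ (2 * m)` is `4 * evenTerm y m`; the 4 is the factor 2 in the derivative times the 2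
    -- in the generating function's denominator.
    refine hasSum_div_pow (c := 4 * 2 ^ (2 * m) / (m.centralBinom : ℝ))
      (continuous_evenPrimitive m) (evenPrimitive_apply_zero m) (fun y hy => ?_)
      (by positivity) hx hxn' ?_
    · refine (hasDerivAt_evenPrimitive hy m).congr_deriv ?_
      rw [evenTerm, mul_pow]
      ring
    · simp only [evenPrimitive, evenTerm, oddTerm, Nat.centralBinom_eq_two_mul_choose] at hC ⊢
      rw [mul_pow 2 x]
      field_simp
  · rintro n x ⟨m, rfl⟩ hx hx0
    rw [Nat.add_sub_cancel, Nat.mul_div_cancel_left m two_pos, ← Nat.range_succ_eq_Icc_zero]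
    have hC := centralBinom_real_pos m
    -- `c * y ^ (2 * m + 1)` is `binomTermDeriv y (m + 1)`, hence the primitive of index `m + 1`.
    refine hasSum_div_pow (c := (2 * m + 1) * (m.centralBinom : ℝ) / 2 ^ (2 * m))
      (continuous_oddPrimitive (m + 1)) (oddPrimitive_apply_zero (m + 1)) (fun y hy => ?_)
      (by positivity) hx (pow_ne_zero _ hx0) ?_
    · refine (hasDerivAt_oddPrimitive hy (m + 1)).congr_deriv ?_
      rw [binomTermDeriv_succ, binomTerm, div_pow]
      ring
    · have h1 (f : ℕ → ℝ) (r : ℕ) : ∑ j ∈ Finset.Icc r m, f j = ∑ j ∈ Finset.Ico r (m + 1), f j :=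
        rfl
      have h2 : ∑ j ∈ Finset.range (m + 1), x * binomTerm x j / (2 * (j : ℝ) + 1)
          = 2 * ∑ j ∈ Finset.range (m + 1),
            ((Nat.choose (2 * j) j : ℕ) : ℝ) / (2 * (j : ℝ) + 1) * (x / 2) ^ (2 * j + 1) := by
        rw [Finset.mul_sum]
        refine Finset.sum_congr rfl fun j _ => ?_
        rw [binomTerm, Nat.centralBinom_eq_two_mul_choose]
        ring
      rw [oddPrimitive, h2]
      simp only [h1, binomTerm, Nat.centralBinom_eq_two_mul_choose, ← mul_assoc] at hC ⊢
      rw [div_pow 2 x, pow_succ 2 (2 * m)]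
      push_cast
      field_simp
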